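/- Let \(E\) be a real separable Banach space, let \(X\) be a centred Gaussian random vector in \(E\) (defined on some probability space), and let \(\xi_1,\xi_2,\dots\) be i.i.d. real random variables (on some, possibly different, probability space) with distribution \(N(0,1)\). Call a sequence \((f_j)_{j\ge1}\) in \(E\) admissible for \(X\) if the series \(\sum_{j=1}^\infty \xi_j f_j\) converges almost surely in \(E\) and its sum has the same distribution as \(X\). Let \(C:E^*\to E\), \(Cu=\mathbb{E}[\langle u,X\rangle X]\), be the covariance operator of \(X\), and let \(H_X\) be the reproducing kernel Hilbert space (Cameron–Martin space) of the kernel \((u,v)\mapsto\langle u,Cv\rangle\) on \(E^*\times E^*\), regarded as a Hilbert subspace \(H_X\subset E\) by identifying \(x\in E\) with the function \(u\mapsto\langle u,x\rangle\) on \(E^*\). Call a sequence \((g_j)_{j\ge1}\) in a real separable Hilbert space \((H,(\cdot,\cdot)_H)\) a Parseval frame for \(H\) if for every \(h\in H\) the series \(\sum_{j=1}^\infty (g_j,h)_H\,g_j\) converges in \(H\) with sum \(h\). Then a sequence \((f_j)_{j\ge1}\) in \(E\) is admissible for \(X\) if and only if \(f_j\in H_X\) for every \(j\) and \((f_j)_{j\ge1}\)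 is a Parseval frame for \(H_X\). -/

import Mathlib

open MeasureTheory ProbabilityTheory Filter Topology

noncomputable section

/-- A sequence `g` in a real Hilbert space `H` is a Parseval frame for `H` if, for every `h`, the
series `∑ j, (g j, h) g j` converges in `H` (as a limit of its partial sums) with sum `h`. -/
def IsParsevalFrame {H : Type*} [NormedAddCommGroup H] [InnerProductSpace ℝ H]
    (g : ℕ → H) : Prop :=
  ∀ h : H, Tendsto (fun n : ℕ => ∑ j ∈ Finset.range n, (inner ℝ (g j) h) • g j) atTop (𝓝 h)

/-- Given real random variables `ξ j` on `(Ω', Q)`, a sequence `f` in `E` is admissible for the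
random vector `X` on `(Ω, P)` if the series `∑ j, ξ j • f j` converges almost surely in `E` and its
sum `Y` has the same distribution as `X`. -/
def IsAdmissible {Ω Ω' E : Type*} [MeasurableSpace Ω] [MeasurableSpace Ω']
    [NormedAddCommGroup E] [NormedSpace ℝ E] [MeasurableSpace E]
    (X : Ω → E) (P : Measure Ω) (ξ : ℕ → Ω' → ℝ) (Q : Measure Ω') (f : ℕ → E) : Prop :=
  ∃ Y : Ω' → E,
    (∀ᵐ ω ∂Q, Tendsto (fun n : ℕ => ∑ j ∈ Finset.range n, ξ j ω • f j) atTop (𝓝 (Y ω))) ∧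
    IdentDistrib X Y P Q

section CameronMartin

variable {Ω E : Type*} [MeasurableSpace Ω] [NormedAddCommGroup E] [NormedSpace ℝ E]
  [MeasurableSpace E]

/-- The covariance operator `C u = 𝔼[⟨u, X⟩ X]` of a centred random vector `X`. -/
def covOperator (X : Ω → E) (P : Measure Ω) (u : StrongDual ℝ E) : E :=
  ∫ ω, u (X ω) • X ω ∂P

/-- The kernel `(u, v) ↦ ⟨u, C v⟩` on `E* × E*`. Mathlib's kernels are operator valued, so the real
number `⟨u, C v⟩` is viewed as the multiplication operator on `ℝ`. -/
def covKernel (X : Ω → E) (P : Measure Ω) :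
    Matrix (StrongDual ℝ E) (StrongDual ℝ E) (ℝ →L[ℝ] ℝ) :=
  Matrix.of fun u v => (u (covOperator X P v)) • ContinuousLinearMap.id ℝ ℝ

variable [CompleteSpace E] [SecondCountableTopology E] [BorelSpace E]
  {X : Ω → E} {P : Measure Ω}

lemma memLp_two_of_gaussian (hX : HasGaussianLaw X P) : MemLp X 2 P :=
  hX.memLp_two

lemma integrable_smul_of_gaussian (hX : HasGaussianLaw X P) (u : StrongDual ℝ E) :
    Integrable (fun ω => u (X ω) • X ω) P := by
  have h1 : MemLp (fun ω => u (X ω)) 2 P := u.comp_memLp' (memLp_two_of_gaussian hX)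
  exact memLp_one_iff_integrable.mp ((memLp_two_of_gaussian hX).smul h1)

lemma integrable_mul_of_gaussian (hX : HasGaussianLaw X P) (u v : StrongDual ℝ E) :
    Integrable (fun ω => u (X ω) * v (X ω)) P :=
  MemLp.integrable_mul (u.comp_memLp' (memLp_two_of_gaussian hX))
    (v.comp_memLp' (memLp_two_of_gaussian hX))

lemma apply_covOperator (hX : HasGaussianLaw X P) (u v : StrongDual ℝ E) :
    u (covOperator X P v) = ∫ ω, u (X ω) * v (X ω) ∂P := by
  rw [covOperator, ← u.integral_comp_comm (integrable_smul_of_gaussian hX v)]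
  simp [mul_comm]

/-- The covariance kernel is symmetric and nonnegative definite. -/
lemma covKernel_posSemidef (hX : HasGaussianLaw X P) : (covKernel X P).PosSemidef := by
  refine ((RKHS.posSemidef_tfae (K := covKernel X P)).out 0 2).mpr ?_
  refine ⟨?_, fun c => ?_⟩
  · ext u v
    simp [covKernel, Matrix.conjTranspose_apply, apply_covOperator hX, mul_comm,
      ContinuousLinearMap.star_eq_adjoint, ContinuousLinearMap.adjoint_id]
  · have h : (c.sum fun x w => c.sum fun x' w' => inner ℝ (covKernel X P x' x w) w')
        = ∫ ω, (∑ x ∈ c.support, c x * x (X ω)) ^ 2 ∂P := by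
      simp only [Finsupp.sum, sq, Finset.sum_mul_sum]
      rw [integral_finsetSum]
      · refine Finset.sum_congr rfl fun x _ => ?_
        rw [integral_finsetSum]
        · refine Finset.sum_congr rfl fun y _ => ?_
          simp only [covKernel, Matrix.of_apply, apply_covOperator hX, smul_apply,
            ContinuousLinearMap.id_apply, smul_eq_mul, inner, star_trivial]
          rw [← integral_mul_const, ← integral_const_mul]
          refine integral_congr_ae (ae_of_all _ fun ω => ?_)
          simp only []
          ring
        · intro y _
          refine ((integrable_mul_of_gaussian hX x y).const_mul (c x * c y)).congr
            (ae_of_all _ fun ω => ?_)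
          simp only []
          ring
      · intro x _
        refine integrable_finsetSum _ fun y _ => ?_
        refine ((integrable_mul_of_gaussian hX x y).const_mul (c x * c y)).congr
          (ae_of_all _ fun ω => ?_)
        simp only []
        ring
    rw [h]
    exact integral_nonneg fun ω => sq_nonneg _

/-- The reproducing kernel Hilbert space (Cameron–Martin space) `H_X` of a centred Gaussian random
vector `X`: the Hilbert space of functions on `E*` with reproducing kernel `(u, v) ↦ ⟨u, C v⟩`. -/
def CameronMartinSpace (hX : HasGaussianLaw X P) : Type _ :=
  haveI := Fact.mk (covKernel_posSemidef hX)
  RKHS.OfKernel (covKernel X P)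

namespace CameronMartinSpace

instance (hX : HasGaussianLaw X P) : NormedAddCommGroup (CameronMartinSpace hX) :=
  haveI := Fact.mk (covKernel_posSemidef hX)
  inferInstanceAs (NormedAddCommGroup (RKHS.OfKernel (covKernel X P)))

instance (hX : HasGaussianLaw X P) : InnerProductSpace ℝ (CameronMartinSpace hX) :=
  haveI := Fact.mk (covKernel_posSemidef hX)
  inferInstanceAs (InnerProductSpace ℝ (RKHS.OfKernel (covKernel X P)))

instance (hX : HasGaussianLaw X P) : CompleteSpace (CameronMartinSpace hX) :=
  haveI := Fact.mk (covKernel_posSemidef hX)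
  inferInstanceAs (CompleteSpace (RKHS.OfKernel (covKernel X P)))

instance (hX : HasGaussianLaw X P) : RKHS ℝ (CameronMartinSpace hX) (StrongDual ℝ E) ℝ :=
  haveI := Fact.mk (covKernel_posSemidef hX)
  inferInstanceAs (RKHS ℝ (RKHS.OfKernel (covKernel X P)) (StrongDual ℝ E) ℝ)

lemma kernel_eq (hX : HasGaussianLaw X P) :
    RKHS.kernel (CameronMartinSpace hX) = covKernel X P :=
  haveI := Fact.mk (covKernel_posSemidef hX)
  RKHS.OfKernel.kernel_ofKernel (K := covKernel X P)

lemma kerFun_apply (hX : HasGaussianLaw X P) (u v : StrongDual ℝ E) (t : ℝ) :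
    RKHS.kerFun (CameronMartinSpace hX) v t u = u (t • covOperator X P v) := by
  rw [RKHS.kerFun_apply, kernel_eq]
  simp [covKernel, mul_comm]

/-- If `h ∈ H_X` is the function `u ↦ ⟨u, x⟩`, then `‖x‖ ≤ (𝔼‖X‖²)^(1/2) ‖h‖`. -/
lemma norm_le_of_repr (hX : HasGaussianLaw X P) {h : CameronMartinSpace hX} {x : E}
    (hx : ∀ u : StrongDual ℝ E, h u = u x) : ‖x‖ ≤ √(∫ ω, ‖X ω‖ ^ 2 ∂P) * ‖h‖ := by
  refine NormedSpace.norm_le_dual_bound ℝ x (by positivity) fun u => ?_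
  rw [← hx u]
  refine (RKHS.norm_apply_le h u).trans ?_
  have h2 : ‖RKHS.kernel (CameronMartinSpace hX) u u‖ ≤ ‖u‖ ^ 2 * ∫ ω, ‖X ω‖ ^ 2 ∂P := by
    rw [kernel_eq, covKernel, Matrix.of_apply, norm_smul, apply_covOperator hX]
    have h3 : 0 ≤ ∫ ω, u (X ω) * u (X ω) ∂P := integral_nonneg fun ω => mul_self_nonneg _
    rw [ContinuousLinearMap.norm_id, mul_one, Real.norm_of_nonneg h3, ← integral_const_mul]
    refine integral_mono (integrable_mul_of_gaussian hX u u)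
      ((memLp_two_of_gaussian hX).integrable_norm_pow (by norm_num) |>.const_mul _) fun ω => ?_
    have h4 := u.le_opNorm (X ω)
    have h5 : u (X ω) * u (X ω) = ‖u (X ω)‖ ^ 2 := by rw [Real.norm_eq_abs, sq_abs, sq]
    simp only [h5, ← mul_pow]
    gcongr
  have h6 : √‖RKHS.kernel (CameronMartinSpace hX) u u‖ ≤ ‖u‖ * √(∫ ω, ‖X ω‖ ^ 2 ∂P) := by
    refine (Real.sqrt_le_sqrt h2).trans_eq ?_
    rw [Real.sqrt_mul (sq_nonneg _), Real.sqrt_sq (norm_nonneg _)]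
  calc ‖h‖ * √‖RKHS.kernel (CameronMartinSpace hX) u u‖
      ≤ ‖h‖ * (‖u‖ * √(∫ ω, ‖X ω‖ ^ 2 ∂P)) := by gcongr
    _ = √(∫ ω, ‖X ω‖ ^ 2 ∂P) * ‖h‖ * ‖u‖ := by ring

/-- The elements of `H_X` that are evaluations `u ↦ ⟨u, x⟩` at some point `x` of `E`. -/
def reprSubmodule (hX : HasGaussianLaw X P) : Submodule ℝ (CameronMartinSpace hX) where
  carrier := {h | ∃ x : E, ∀ u : StrongDual ℝ E, h u = u x}
  add_mem' := by
    rintro a b ⟨x, hx⟩ ⟨y, hy⟩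
    exact ⟨x + y, fun u => by simp [hx, hy]⟩
  zero_mem' := ⟨0, fun u => by simp⟩
  smul_mem' := by
    rintro c a ⟨x, hx⟩
    exact ⟨c • x, fun u => by simp [hx]⟩

lemma isClosed_reprSubmodule (hX : HasGaussianLaw X P) :
    IsClosed (reprSubmodule hX : Set (CameronMartinSpace hX)) := by
  refine IsSeqClosed.isClosed fun h k hh hk => ?_
  choose x hx using hh
  have hd : ∀ m n, dist (x m) (x n) ≤ √(∫ ω, ‖X ω‖ ^ 2 ∂P) * dist (h m) (h n) := by
    intro m n
    rw [dist_eq_norm, dist_eq_norm]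
    exact norm_le_of_repr hX fun u => by simp [hx]
  have hc : CauchySeq x := by
    have h1 := hk.cauchySeq
    rw [cauchySeq_iff_tendsto_dist_atTop_0] at h1 ⊢
    have h2 := h1.const_mul √(∫ ω, ‖X ω‖ ^ 2 ∂P)
    rw [mul_zero] at h2
    exact squeeze_zero (fun _ => dist_nonneg) (fun p => hd p.1 p.2) h2
  obtain ⟨y, hy⟩ := cauchySeq_tendsto_of_complete hc
  refine ⟨y, fun u => ?_⟩
  have h1 : Tendsto (fun n => h n u) atTop (𝓝 (k u)) :=
    ((RKHS.continuous_eval u).tendsto k).comp hk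
  have h2 : Tendsto (fun n => u (x n)) atTop (𝓝 (u y)) := (u.continuous.tendsto y).comp hy
  simp only [hx] at h1
  exact tendsto_nhds_unique h1 h2

/-- Every element of `H_X` is the function `u ↦ ⟨u, x⟩` for some point `x` of `E`. -/
lemma exists_repr (hX : HasGaussianLaw X P) (h : CameronMartinSpace hX) :
    ∃ x : E, ∀ u : StrongDual ℝ E, h u = u x := by
  have h1 : (Submodule.span ℝ
      {RKHS.kerFun (CameronMartinSpace hX) v t | (v) (t)}).topologicalClosure
        ≤ reprSubmodule hX := by
    refine Submodule.topologicalClosure_minimal _ (Submodule.span_le.mpr ?_)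
      (isClosed_reprSubmodule hX)
    rintro _ ⟨v, t, rfl⟩
    exact ⟨t • covOperator X P v, fun u => kerFun_apply hX u v t⟩
  rw [RKHS.kerFun_dense] at h1
  exact h1 Submodule.mem_top

/-- The inclusion map `H_X → E`: it sends `h ∈ H_X` to the unique `x ∈ E` such that `h` is the
function `u ↦ ⟨u, x⟩` on `E*`. -/
def inclusion (hX : HasGaussianLaw X P) : CameronMartinSpace hX →L[ℝ] E :=
  LinearMap.mkContinuous
    { toFun := fun h => (exists_repr hX h).choose
      map_add' := fun a b => by
        refine (SeparatingDual.eq_iff_forall_dual_eq (R := ℝ)).mpr fun u => ?_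
        rw [map_add, ← (exists_repr hX (a + b)).choose_spec, ← (exists_repr hX a).choose_spec,
          ← (exists_repr hX b).choose_spec, RKHS.coe_add, Pi.add_apply]
      map_smul' := fun c a => by
        refine (SeparatingDual.eq_iff_forall_dual_eq (R := ℝ)).mpr fun u => ?_
        rw [map_smul, ← (exists_repr hX (c • a)).choose_spec, ← (exists_repr hX a).choose_spec,
          RKHS.coe_smul, Pi.smul_apply, RingHom.id_apply] }
    √(∫ ω, ‖X ω‖ ^ 2 ∂P) fun h => norm_le_of_repr hX (exists_repr hX h).choose_spec

/-- The defining property of the inclusion `H_X → E`. -/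
lemma apply_inclusion (hX : HasGaussianLaw X P) (h : CameronMartinSpace hX)
    (u : StrongDual ℝ E) : u (inclusion hX h) = h u :=
  ((exists_repr hX h).choose_spec u).symm

lemma inclusion_injective (hX : HasGaussianLaw X P) : Function.Injective (inclusion hX) := by
  intro a b hab
  refine RKHS.ext fun u => ?_
  rw [← apply_inclusion, ← apply_inclusion, hab]

/-- The inclusion maps the kernel function at `u` to `C u`. -/
lemma inclusion_kerFun (hX : HasGaussianLaw X P) (u : StrongDual ℝ E) :
    inclusion hX (RKHS.kerFun (CameronMartinSpace hX) u 1) = covOperator X P u := by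
  refine (SeparatingDual.eq_iff_forall_dual_eq (R := ℝ)).mpr fun v => ?_
  rw [apply_inclusion, kerFun_apply, one_smul]

/-- The reproducing property `(h, C u)_H = ⟨u, h⟩`. -/
lemma inner_kerFun (hX : HasGaussianLaw X P) (h : CameronMartinSpace hX)
    (u : StrongDual ℝ E) :
    inner ℝ h (RKHS.kerFun (CameronMartinSpace hX) u 1) = u (inclusion hX h) := by
  rw [RKHS.inner_kerFun, apply_inclusion]
  simp

end CameronMartinSpace

end CameronMartin

end

/-! Both conditions are equivalent to the scalar identity ∑ ⟨u, f_j⟩² = ⟨u, Cu⟩ for every `u` in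
`E*`.

For frames, the reproducing property gives (h, Cu)_H = ⟨u, h⟩ and ‖Cu‖²_H = ⟨u, Cu⟩, so the identity
says ∑ (f_j, h)² = ‖h‖² on the dense set of all h = Cu. Each single term is at most ⟨u, Cu⟩, which
by Riesz puts f_j in H_X; a density argument (`isParsevalFrame_of_dense`) then gives the frame
expansion.

For admissibility, the identity is read off from characteristic functions. The converse needs almost
sure convergence in `E`, in the spirit of Itô–Nisio (`ae_exists_tendsto_gaussian_series`). Along a
separating sequence v_k the scalar series are L²-bounded martingales with limits Z_k. The family
(Z_k) has the joint law of (⟨v_k, X⟩), which is carried by the image of `E`, so Z_k = ⟨v_k, Y⟩ for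
some Y distributed as X. The partial sums are then conditional expectations of Y, and Banach-valued
martingale convergence applies (`ae_exists_tendsto_condExp`). -/

/-! ### Parseval frames in Hilbert space -/

section Frames

variable {H : Type*} [NormedAddCommGroup H] [InnerProductSpace ℝ H] {g : ℕ → H}

lemma inner_frame_sum (g : ℕ → H) (x y : H) (n : ℕ) :
    inner ℝ (∑ j ∈ Finset.range n, (inner ℝ (g j) x) • g j) y
      = ∑ j ∈ Finset.range n, inner ℝ (g j) x * inner ℝ (g j) y := by
  simp [sum_inner, inner_smul_left]

lemma IsParsevalFrame.tendsto_sum_inner_sq (hg : IsParsevalFrame g) (x : H) :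
    Tendsto (fun n : ℕ => ∑ j ∈ Finset.range n, (inner ℝ (g j) x) ^ 2) atTop
      (𝓝 (‖x‖ ^ 2)) := by
  have h := (hg x).inner (𝕜 := ℝ) (tendsto_const_nhds (x := x))
  rw [real_inner_self_eq_norm_sq] at h
  refine h.congr fun n => ?_
  rw [inner_frame_sum]
  exact Finset.sum_congr rfl fun j _ => (sq _).symm

/-- Pair the partial sum S with itself: ‖S‖² = ∑ (g_j, x)(g_j, S). Cauchy–Schwarz and the Bessel
bound at S leave a factor ‖S‖² to cancel. -/
lemma norm_frame_sum_sq_le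
    (hb : ∀ (x : H) (n : ℕ), ∑ j ∈ Finset.range n, (inner ℝ (g j) x) ^ 2 ≤ ‖x‖ ^ 2)
    (x : H) (n : ℕ) :
    ‖∑ j ∈ Finset.range n, (inner ℝ (g j) x) • g j‖ ^ 2
      ≤ ∑ j ∈ Finset.range n, (inner ℝ (g j) x) ^ 2 := by
  set S := ∑ j ∈ Finset.range n, (inner ℝ (g j) x) • g j with hS
  have h1 : ‖S‖ ^ 2 = ∑ j ∈ Finset.range n, inner ℝ (g j) x * inner ℝ (g j) S := by
    rw [← real_inner_self_eq_norm_sq, hS, inner_frame_sum]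
  have h2 := Finset.sum_mul_sq_le_sq_mul_sq (Finset.range n) (fun j => inner ℝ (g j) x)
    (fun j => inner ℝ (g j) S)
  rw [← h1] at h2
  have h3 := hb S n
  have h0 : 0 ≤ ∑ j ∈ Finset.range n, (inner ℝ (g j) x) ^ 2 :=
    Finset.sum_nonneg fun _ _ => sq_nonneg _
  have h4 := h2.trans (mul_le_mul_of_nonneg_left h3 h0)
  rcases (sq_nonneg ‖S‖).eq_or_lt with h5 | h5
  · rwa [← h5]
  · rw [sq (‖S‖ ^ 2)] at h4
    exact le_of_mul_le_mul_right h4 h5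

/-- The Bessel bound is a closed condition, so it passes from `D` to `H` and makes all partial-sum
operators contractions. Convergence on `D` therefore extends to `H`. -/
lemma isParsevalFrame_of_dense {D : Set H} (hD : Dense D)
    (h : ∀ x ∈ D, Tendsto (fun n : ℕ => ∑ j ∈ Finset.range n, (inner ℝ (g j) x) ^ 2) atTop
      (𝓝 (‖x‖ ^ 2))) : IsParsevalFrame g := by
  have hb : ∀ (x : H) (n : ℕ), ∑ j ∈ Finset.range n, (inner ℝ (g j) x) ^ 2 ≤ ‖x‖ ^ 2 := by
    intro x n
    have hc : IsClosed {x : H | ∑ j ∈ Finset.range n, (inner ℝ (g j) x) ^ 2 ≤ ‖x‖ ^ 2} :=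
      isClosed_le (by fun_prop) (by fun_prop)
    refine hc.closure_subset_iff.mpr (fun y hy => ?_) (hD x)
    refine (monotone_nat_of_le_succ fun k => ?_).ge_of_tendsto (h y hy) n
    rw [Finset.sum_range_succ]
    exact le_add_of_nonneg_right (sq_nonneg _)
  have hS : ∀ (x : H) (n : ℕ), ‖∑ j ∈ Finset.range n, (inner ℝ (g j) x) • g j‖ ≤ ‖x‖ :=
    fun x n => le_of_sq_le_sq ((norm_frame_sum_sq_le hb x n).trans (hb x n)) (norm_nonneg _)
  have hconv : ∀ x ∈ D, Tendsto
      (fun n : ℕ => ∑ j ∈ Finset.range n, (inner ℝ (g j) x) • g j) atTop (𝓝 x) := by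
    intro x hx
    rw [tendsto_iff_norm_sub_tendsto_zero]
    have h1 : Tendsto (fun n : ℕ =>
        √(‖x‖ ^ 2 - ∑ j ∈ Finset.range n, (inner ℝ (g j) x) ^ 2)) atTop (𝓝 0) := by
      have := ((h x hx).const_sub (‖x‖ ^ 2)).sqrt
      simpa using this
    refine squeeze_zero (fun _ => norm_nonneg _) (fun n => Real.le_sqrt_of_sq_le ?_) h1
    have h2 : inner ℝ (∑ j ∈ Finset.range n, (inner ℝ (g j) x) • g j) x
        = ∑ j ∈ Finset.range n, (inner ℝ (g j) x) ^ 2 := by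
      rw [inner_frame_sum]
      exact Finset.sum_congr rfl fun j _ => (sq _).symm
    -- With s = ∑ (g_j, x)², the expansion is ‖S‖² − 2s + ‖x‖², and ‖S‖² ≤ s.
    rw [norm_sub_sq_real, h2]
    linarith [norm_frame_sum_sq_le hb x n]
  intro x
  rw [Metric.tendsto_atTop]
  intro ε hε
  obtain ⟨y, hy, hxy⟩ := hD.exists_dist_lt x (ε := ε / 3) (by positivity)
  obtain ⟨N, hN⟩ := Metric.tendsto_atTop.mp (hconv y hy) (ε / 3) (by positivity)
  refine ⟨N, fun n hn => ?_⟩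
  have h1 := hS (x - y) n
  have h2 : ∑ j ∈ Finset.range n, (inner ℝ (g j) (x - y)) • g j
      = ∑ j ∈ Finset.range n, (inner ℝ (g j) x) • g j
        - ∑ j ∈ Finset.range n, (inner ℝ (g j) y) • g j := by
    simp [inner_sub_right, sub_smul, Finset.sum_sub_distrib]
  rw [h2, ← dist_eq_norm, ← dist_eq_norm] at h1
  have h3 := hN n hn
  have h4 := dist_triangle4 (∑ j ∈ Finset.range n, (inner ℝ (g j) x) • g j)
    (∑ j ∈ Finset.range n, (inner ℝ (g j) y) • g j) y x
  rw [dist_comm y x] at h4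
  linarith

end Frames

/-! ### Frames of the Cameron–Martin space in terms of functionals -/

section CameronMartinFrames

variable {Ω E : Type*} [MeasurableSpace Ω] [NormedAddCommGroup E] [NormedSpace ℝ E]
  [MeasurableSpace E] [CompleteSpace E] [SecondCountableTopology E] [BorelSpace E]
  {X : Ω → E} {P : Measure Ω}

namespace CameronMartinSpace

/-- The linear map `E* → H_X` sending `u` to the kernel function at `u`. -/
noncomputable def kerMap (hX : HasGaussianLaw X P) : StrongDual ℝ E →ₗ[ℝ] CameronMartinSpace hX where
  toFun u := RKHS.kerFun (CameronMartinSpace hX) u 1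
  map_add' u v := ext_inner_left ℝ fun h => by
    rw [inner_add_right, inner_kerFun, inner_kerFun, inner_kerFun, add_apply]
  map_smul' c u := ext_inner_left ℝ fun h => by
    rw [RingHom.id_apply, inner_smul_right, inner_kerFun, inner_kerFun, smul_apply,
      smul_eq_mul]

lemma inner_kerMap (hX : HasGaussianLaw X P) (h : CameronMartinSpace hX)
    (u : StrongDual ℝ E) : inner ℝ h (kerMap hX u) = u (inclusion hX h) :=
  inner_kerFun hX h u

lemma norm_kerMap_sq (hX : HasGaussianLaw X P) (u : StrongDual ℝ E) :
    ‖kerMap hX u‖ ^ 2 = u (covOperator X P u) := by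
  rw [← real_inner_self_eq_norm_sq, inner_kerMap, ← inclusion_kerFun hX]
  rfl

lemma denseRange_kerMap (hX : HasGaussianLaw X P) : DenseRange (kerMap hX) := by
  have h1 : Submodule.span ℝ {RKHS.kerFun (CameronMartinSpace hX) v t | (v) (t)}
      ≤ LinearMap.range (kerMap hX) := by
    refine Submodule.span_le.mpr ?_
    rintro _ ⟨v, t, rfl⟩
    refine ⟨t • v, ?_⟩
    rw [map_smul, kerMap, LinearMap.coe_mk, AddHom.coe_mk, ← map_smul, smul_eq_mul, mul_one]
  have h2 := Submodule.topologicalClosure_mono h1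
  rw [RKHS.kerFun_dense, top_le_iff, ← Submodule.dense_iff_topologicalClosure_eq_top] at h2
  exact h2

/-- A point `x` of `E` with `|⟨u, x⟩|² ≤ ⟨u, C u⟩` for all `u` lies in `H_X`. -/
lemma exists_inclusion_eq (hX : HasGaussianLaw X P) {x : E}
    (hx : ∀ u : StrongDual ℝ E, (u x) ^ 2 ≤ u (covOperator X P u)) :
    ∃ h : CameronMartinSpace hX, inclusion hX h = x := by
  -- The hypothesis bounds evaluation at `x` by the norm of `kerMap hX u`, so evaluation induces a
  -- bounded functional on the dense range of `kerMap`. Its Riesz representative is the required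
  -- element.
  let φ : StrongDual ℝ E →ₗ[ℝ] ℝ := (ContinuousLinearMap.apply ℝ ℝ x).toLinearMap
  have hφ : ∃ C, ∀ u, ‖φ u‖ ≤ C * ‖kerMap hX u‖ := by
    refine ⟨1, fun u => ?_⟩
    rw [one_mul]
    refine le_of_sq_le_sq ?_ (norm_nonneg _)
    rw [norm_kerMap_sq, Real.norm_eq_abs, sq_abs]
    exact hx u
  let T := φ.extendOfNorm (kerMap hX)
  refine ⟨(InnerProductSpace.toDual ℝ _).symm T, ?_⟩
  refine (SeparatingDual.eq_iff_forall_dual_eq (R := ℝ)).mpr fun u => ?_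
  rw [← inner_kerMap, InnerProductSpace.toDual_symm_apply]
  exact LinearMap.extendOfNorm_eq (denseRange_kerMap hX) hφ u

lemma exists_isParsevalFrame_iff (hX : HasGaussianLaw X P) (f : ℕ → E) :
    (∃ g : ℕ → CameronMartinSpace hX, (∀ j, inclusion hX (g j) = f j) ∧ IsParsevalFrame g) ↔
      ∀ u : StrongDual ℝ E, Tendsto (fun n : ℕ => ∑ j ∈ Finset.range n, (u (f j)) ^ 2) atTop
        (𝓝 (u (covOperator X P u))) := by
  constructor
  · rintro ⟨g, hgf, hg⟩ u
    have h := hg.tendsto_sum_inner_sq (kerMap hX u)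
    simpa only [inner_kerMap, hgf, norm_kerMap_sq] using h
  · intro h
    have hle : ∀ (j : ℕ) (u : StrongDual ℝ E), (u (f j)) ^ 2 ≤ u (covOperator X P u) := by
      intro j u
      refine le_trans ?_ ((monotone_nat_of_le_succ fun k => ?_).ge_of_tendsto (h u) (j + 1))
      · exact Finset.single_le_sum (f := fun i => (u (f i)) ^ 2) (fun _ _ => sq_nonneg _)
          (Finset.self_mem_range_succ j)
      · rw [Finset.sum_range_succ _ k]
        exact le_add_of_nonneg_right (sq_nonneg _)
    choose g hg using fun j => exists_inclusion_eq hX (hle j)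
    refine ⟨g, hg, isParsevalFrame_of_dense (denseRange_kerMap hX) ?_⟩
    rintro _ ⟨u, rfl⟩
    simpa only [inner_kerMap, hg, norm_kerMap_sq] using h u

end CameronMartinSpace

end CameronMartinFrames

/-! ### Martingale convergence in Banach spaces -/

section VectorMartingale

variable {Ω F : Type*} {m0 : MeasurableSpace Ω} {μ : Measure Ω} [IsFiniteMeasure μ]
  [NormedAddCommGroup F] [NormedSpace ℝ F] [CompleteSpace F]

/-- Closedness in L¹ without a maximal inequality: ‖E[f − g_k | ℱ_n]‖ is at most E[‖f − g_k‖ | ℱ_n],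
a real martingale with almost sure limit `W k`. Since `W k` tends to 0 in L¹, it does so almost
surely along a subsequence. -/
lemma ae_cauchySeq_condExp_of_tendsto (ℱ : Filtration ℕ m0) {g : ℕ → Ω → F} {f : Ω → F}
    (hf : Integrable f μ) (hg : ∀ k, Integrable (g k) μ)
    (hgf : Tendsto (fun k => eLpNorm (f - g k) 1 μ) atTop (𝓝 0))
    (hc : ∀ k, ∀ᵐ ω ∂μ, CauchySeq fun n => (μ[g k | ℱ n]) ω) :
    ∀ᵐ ω ∂μ, CauchySeq fun n => (μ[f | ℱ n]) ω := by
  let V : ℕ → Ω → ℝ := fun k ω => ‖(f - g k) ω‖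
  have hV : ∀ k, Integrable (V k) μ := fun k => (hf.sub (hg k)).norm
  let W : ℕ → Ω → ℝ := fun k => μ[V k | ⨆ n, ℱ n]
  have hW : Tendsto (fun k => eLpNorm (W k - 0) 1 μ) atTop (𝓝 0) := by
    refine tendsto_of_tendsto_of_tendsto_of_le_of_le tendsto_const_nhds hgf
      (fun _ => zero_le) fun k => ?_
    simp only [sub_zero, W]
    refine (eLpNorm_condExp_le_eLpNorm _ le_rfl).trans_eq ?_
    exact eLpNorm_norm _
  obtain ⟨ns, -, hns⟩ := (tendstoInMeasure_of_tendsto_eLpNorm one_ne_zero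
    (fun k => (integrable_condExp (m := ⨆ n, ℱ n) (f := V k)).aestronglyMeasurable)
    aestronglyMeasurable_const hW).exists_seq_tendsto_ae
  have h1 : ∀ᵐ ω ∂μ, ∀ k, Tendsto (fun n => (μ[V k | ℱ n]) ω) atTop (𝓝 (W k ω)) :=
    ae_all_iff.mpr fun k => tendsto_ae_condExp (V k)
  have h2 : ∀ᵐ ω ∂μ, ∀ k n, ‖(μ[f | ℱ n]) ω - (μ[g k | ℱ n]) ω‖ ≤ (μ[V k | ℱ n]) ω := by
    refine ae_all_iff.mpr fun k => ae_all_iff.mpr fun n => ?_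
    filter_upwards [norm_condExp_le (m := ℱ n) (μ := μ) (f - g k),
      condExp_sub hf (hg k) (ℱ n)] with ω h3 h4
    rw [h4] at h3
    exact h3
  filter_upwards [hns, h1, h2, ae_all_iff.mpr hc] with ω h3 h4 h5 h6
  rw [Metric.cauchySeq_iff']
  intro ε hε
  obtain ⟨i, hi⟩ := (h3.eventually_lt_const (show (0 : Ω → ℝ) ω < ε / 4 by
    simpa using (by positivity : 0 < ε / 4))).exists
  obtain ⟨N₁, hN₁⟩ := eventually_atTop.mp ((h4 (ns i)).eventually_lt_const hi)
  obtain ⟨N₂, hN₂⟩ := Metric.cauchySeq_iff.mp (h6 (ns i)) (ε / 4) (by positivity)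
  refine ⟨max N₁ N₂, fun n hn => ?_⟩
  have a1 := (h5 (ns i) n).trans_lt (hN₁ n (le_of_max_le_left hn))
  have a2 := (h5 (ns i) (max N₁ N₂)).trans_lt (hN₁ _ (le_max_left _ _))
  have a3 := hN₂ n (le_of_max_le_right hn) (max N₁ N₂) (le_max_right _ _)
  rw [← dist_eq_norm] at a1 a2
  rw [dist_comm] at a2
  refine (dist_triangle4 _ _ _ _).trans_lt (lt_trans (add_lt_add (add_lt_add a1 a3) a2) ?_)
  linarith

/-- **Martingale convergence in Banach spaces**: the conditional expectations of an integrable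
random vector along a filtration converge almost surely. -/
theorem ae_exists_tendsto_condExp (ℱ : Filtration ℕ m0) {Y : Ω → F} (hY : Integrable Y μ) :
    ∀ᵐ ω ∂μ, ∃ c, Tendsto (fun n => (μ[Y | ℱ n]) ω) atTop (𝓝 c) := by
  suffices h : ∀ᵐ ω ∂μ, CauchySeq fun n => (μ[Y | ℱ n]) ω by
    filter_upwards [h] with ω hω using cauchySeq_tendsto_of_complete hω
  refine Integrable.induction (fun Y => ∀ᵐ ω ∂μ, CauchySeq fun n => (μ[Y | ℱ n]) ω)
    ?_ ?_ ?_ ?_ hY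
  · intro c s hs _
    -- Factoring the indicator through the line spanned by `c` reduces to the real-valued theorem.
    let L : ℝ →L[ℝ] F := ContinuousLinearMap.toSpanSingleton ℝ c
    have hL : s.indicator (fun _ => c) = L ∘ s.indicator (fun _ => (1 : ℝ)) := by
      ext ω
      by_cases hω : ω ∈ s <;> simp [L, hω]
    have hi : Integrable (s.indicator fun _ => (1 : ℝ)) μ := (integrable_const 1).indicator hs
    have h1 : ∀ᵐ ω ∂μ, ∀ n, L ((μ[s.indicator (fun _ => (1 : ℝ)) | ℱ n]) ω)
        = (μ[L ∘ s.indicator (fun _ => (1 : ℝ)) | ℱ n]) ω :=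
      ae_all_iff.mpr fun n => ContinuousLinearMap.comp_condExp_comm hi L
    rw [hL]
    filter_upwards [h1, tendsto_ae_condExp (ℱ := ℱ) (s.indicator fun _ => (1 : ℝ))] with ω h2 h3
    simp only [← h2]
    exact ((L.continuous.tendsto _).comp h3).cauchySeq
  · intro f g _ hf hg hcf hcg
    have h1 : ∀ᵐ ω ∂μ, ∀ n, (μ[f + g | ℱ n]) ω = (μ[f | ℱ n]) ω + (μ[g | ℱ n]) ω :=
      ae_all_iff.mpr fun n => condExp_add hf hg (ℱ n)
    filter_upwards [h1, hcf, hcg] with ω h2 h3 h4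
    simp only [h2]
    exact h3.add h4
  · refine IsSeqClosed.isClosed fun g f hg hgf => ?_
    refine ae_cauchySeq_condExp_of_tendsto ℱ (L1.integrable_coeFn f)
      (fun k => L1.integrable_coeFn (g k)) ?_ hg
    have h1 := (Lp.tendsto_Lp_iff_tendsto_eLpNorm' g f).mp hgf
    refine h1.congr fun k => ?_
    exact eLpNorm_sub_comm _ _ _ _
  · intro f g hfg _ hcf
    have h1 : ∀ᵐ ω ∂μ, ∀ n, (μ[f | ℱ n]) ω = (μ[g | ℱ n]) ω :=
      ae_all_iff.mpr fun n => condExp_congr_ae hfg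
    filter_upwards [h1, hcf] with ω h2 h3
    simpa only [← h2] using h3

end VectorMartingale

/-! ### Scalar Gaussian series -/

section GaussianSeries

variable {Ω : Type*} [MeasurableSpace Ω] {Q : Measure Ω} {ξ : ℕ → Ω → ℝ}

lemma hasLaw_gaussian_sum (hξ : iIndepFun ξ Q) (hlaw : ∀ j, HasLaw (ξ j) (gaussianReal 0 1) Q)
    (a : ℕ → ℝ) (n : ℕ) :
    HasLaw (fun ω => ∑ j ∈ Finset.range n, ξ j ω * a j)
      (gaussianReal 0 (∑ j ∈ Finset.range n, (a j) ^ 2).toNNReal) Q := by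
  have := hξ.isProbabilityMeasure
  have hm : ∀ j, AEMeasurable (fun ω => ξ j ω * a j) Q :=
    fun j => (hlaw j).aemeasurable.mul_const _
  have hind : iIndepFun (fun j ω => ξ j ω * a j) Q :=
    hξ.comp (fun j x => x * a j) fun j => by fun_prop
  induction n with
  | zero => exact ⟨by fun_prop, by simp⟩
  | succ n ih =>
    refine ⟨Finset.aemeasurable_fun_sum _ fun j _ => hm j, ?_⟩
    have h1 := hind.indepFun_finsetSum_of_notMem₀ hm (Finset.notMem_range_self (n := n))
    have h2 := gaussianReal_add_gaussianReal_of_indepFun h1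
      (by simpa only [Finset.sum_fn] using ih.map_eq)
      (gaussianReal_mul_const (hlaw n) (a n)).map_eq
    rw [← Finset.sum_range_succ (fun j ω => ξ j ω * a j)] at h2
    rw [← Finset.sum_fn, h2]
    congr 1
    · simp
    · rw [Finset.sum_range_succ, Real.toNNReal_add (Finset.sum_nonneg fun _ _ => sq_nonneg _)
        (sq_nonneg _), mul_one, Real.toNNReal_of_nonneg (sq_nonneg (a n))]

lemma integral_exp_gaussian_sum (hξ : iIndepFun ξ Q)
    (hlaw : ∀ j, HasLaw (ξ j) (gaussianReal 0 1) Q) (a : ℕ → ℝ) (n : ℕ) :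
    ∫ ω, Complex.exp ((∑ j ∈ Finset.range n, ξ j ω * a j : ℝ) * Complex.I) ∂Q
      = Complex.exp (-((∑ j ∈ Finset.range n, (a j) ^ 2 : ℝ) : ℂ) / 2) := by
  have h := hasLaw_gaussian_sum hξ hlaw a n
  have h1 := h.integral_comp (f := fun x : ℝ => Complex.exp (x * Complex.I))
    (by fun_prop)
  have h2 := charFun_gaussianReal (μ := 0) (v := (∑ j ∈ Finset.range n, (a j) ^ 2).toNNReal) 1
  rw [charFun_apply_real] at h2
  simp only [Function.comp_def] at h1
  rw [h1]
  simp only [Complex.ofReal_one, one_mul] at h2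
  rw [h2, Real.coe_toNNReal _ (Finset.sum_nonneg fun _ _ => sq_nonneg _)]
  congr 1
  push_cast
  ring

lemma integral_sq_gaussian_sum (hξ : iIndepFun ξ Q)
    (hlaw : ∀ j, HasLaw (ξ j) (gaussianReal 0 1) Q) (a : ℕ → ℝ) (n : ℕ) :
    ∫ ω, (∑ j ∈ Finset.range n, ξ j ω * a j) ^ 2 ∂Q = ∑ j ∈ Finset.range n, (a j) ^ 2 := by
  have h := hasLaw_gaussian_sum hξ hlaw a n
  have h0 : Q[fun ω => ∑ j ∈ Finset.range n, ξ j ω * a j] = 0 := by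
    rw [h.integral_eq, integral_id_gaussianReal]
  have h1 := h.variance_eq
  rw [variance_of_integral_eq_zero h.aemeasurable h0, variance_id_gaussianReal,
    Real.coe_toNNReal _ (Finset.sum_nonneg fun _ _ => sq_nonneg _)] at h1
  exact h1

lemma memLp_gaussian_sum (hξ : iIndepFun ξ Q)
    (hlaw : ∀ j, HasLaw (ξ j) (gaussianReal 0 1) Q) (a : ℕ → ℝ) (n : ℕ) :
    MemLp (fun ω => ∑ j ∈ Finset.range n, ξ j ω * a j) 2 Q := by
  have h := hasLaw_gaussian_sum hξ hlaw a n
  have h1 := memLp_id_gaussianReal (μ := 0) (v := (∑ j ∈ Finset.range n, (a j) ^ 2).toNNReal) 2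
  rw [← h.map_eq] at h1
  exact h1.comp_of_map h.aemeasurable

/-- The characteristic function of the sum of an almost surely convergent Gaussian series. -/
lemma tendsto_exp_of_ae_tendsto_gaussian_sum (hξ : iIndepFun ξ Q)
    (hlaw : ∀ j, HasLaw (ξ j) (gaussianReal 0 1) Q) {a : ℕ → ℝ} {Z : Ω → ℝ}
    (hZ : ∀ᵐ ω ∂Q, Tendsto (fun n => ∑ j ∈ Finset.range n, ξ j ω * a j) atTop (𝓝 (Z ω))) :
    Tendsto (fun n : ℕ => Complex.exp (-((∑ j ∈ Finset.range n, (a j) ^ 2 : ℝ) : ℂ) / 2)) atTop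
      (𝓝 (∫ ω, Complex.exp (Z ω * Complex.I) ∂Q)) := by
  have := hξ.isProbabilityMeasure
  simp only [← integral_exp_gaussian_sum hξ hlaw a]
  refine tendsto_integral_of_dominated_convergence (fun _ => 1) (fun n => ?_)
    (integrable_const 1) (fun n => ae_of_all _ fun ω => ?_) ?_
  · have hm : AEMeasurable (fun ω => ∑ j ∈ Finset.range n, ξ j ω * a j) Q :=
      (hasLaw_gaussian_sum hξ hlaw a n).aemeasurable
    have hc : Continuous fun x : ℝ => Complex.exp (x * Complex.I) := by fun_prop
    exact hc.comp_aestronglyMeasurable hm.aestronglyMeasurable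
  · rw [Complex.norm_exp_ofReal_mul_I]
  · filter_upwards [hZ] with ω hω
    have hc : Continuous fun x : ℝ => Complex.exp (x * Complex.I) := by fun_prop
    exact (hc.tendsto _).comp hω

/-- A sequence of real random variables that is bounded in `L²` is uniformly integrable. -/
lemma uniformIntegrable_of_integral_sq_le [IsProbabilityMeasure Q] {S : ℕ → Ω → ℝ}
    (hS : ∀ n, MemLp (S n) 2 Q) {B : ℝ} (hB : ∀ n, ∫ ω, (S n ω) ^ 2 ∂Q ≤ B) :
    UniformIntegrable S 1 Q := by
  refine uniformIntegrable_of le_rfl ENNReal.one_ne_top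
    (fun n => (hS n).aestronglyMeasurable) fun ε hε => ?_
  have hB0 : 0 ≤ B := (integral_nonneg fun ω => sq_nonneg _).trans (hB 0)
  -- Where |S_n| ≥ C one has |S_n| ≤ S_n² / C, so the tail integral is at most B / C ≤ ε; the + 1
  -- keeps C positive when B = 0.
  let C : ℝ := (B + 1) / ε
  have hC : 0 < C := by positivity
  refine ⟨C.toNNReal, fun n => ?_⟩
  have hle : ∀ ω, ‖({x | C.toNNReal ≤ ‖S n x‖₊}.indicator (S n)) ω‖ ≤ (S n ω) ^ 2 / C := by
    intro ω
    by_cases hω : ω ∈ {x | C.toNNReal ≤ ‖S n x‖₊}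
    · rw [Set.indicator_of_mem hω, le_div_iff₀ hC, ← sq_abs, Real.norm_eq_abs, sq]
      refine mul_le_mul_of_nonneg_left ?_ (abs_nonneg _)
      have h1 : C.toNNReal ≤ ‖S n ω‖₊ := hω
      rw [← NNReal.coe_le_coe, Real.coe_toNNReal _ hC.le] at h1
      exact h1
    · rw [Set.indicator_of_notMem hω, norm_zero]
      positivity
  have hint : Integrable (fun ω => (S n ω) ^ 2 / C) Q := (hS n).integrable_sq.div_const C
  rw [eLpNorm_one_eq_lintegral_enorm]
  calc ∫⁻ ω, ‖({x | C.toNNReal ≤ ‖S n x‖₊}.indicator (S n)) ω‖ₑ ∂Q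
      ≤ ∫⁻ ω, ENNReal.ofReal ((S n ω) ^ 2 / C) ∂Q := by
        refine lintegral_mono fun ω => ?_
        rw [← ofReal_norm]
        exact ENNReal.ofReal_le_ofReal (hle ω)
    _ = ENNReal.ofReal (∫ ω, (S n ω) ^ 2 / C ∂Q) :=
        (ofReal_integral_eq_lintegral_ofReal hint (ae_of_all _ fun ω => by positivity)).symm
    _ ≤ ENNReal.ofReal ε := by
        refine ENNReal.ofReal_le_ofReal ?_
        rw [integral_div, div_le_iff₀ hC, show ε * C = B + 1 by simp only [C]; field_simp]
        linarith [hB n]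

/-- The sum has n + 1 terms because the natural filtration at time n already contains ξ_n. -/
lemma martingale_gaussian_sum (hξ : iIndepFun ξ Q) (hm : ∀ j, StronglyMeasurable (ξ j))
    (hlaw : ∀ j, HasLaw (ξ j) (gaussianReal 0 1) Q) (a : ℕ → ℝ) :
    Martingale (fun n ω => ∑ j ∈ Finset.range (n + 1), ξ j ω * a j)
      (Filtration.natural ξ hm) Q := by
  have := hξ.isProbabilityMeasure
  have hint : ∀ n, Integrable (fun ω => ∑ j ∈ Finset.range n, ξ j ω * a j) Q :=
    fun n => (memLp_gaussian_sum hξ hlaw a n).integrable one_le_two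
  have hadp : StronglyAdapted (Filtration.natural ξ hm)
      fun n ω => ∑ j ∈ Finset.range (n + 1), ξ j ω * a j := by
    intro n
    refine Finset.stronglyMeasurable_fun_sum _ fun j hj => ?_
    exact (((Filtration.stronglyAdapted_natural hm) j).mono
      ((Filtration.natural ξ hm).mono (Finset.mem_range_succ_iff.mp hj))).mul_const _
  refine martingale_nat hadp (fun n => hint (n + 1)) fun n => ?_
  have hξi : Integrable (ξ (n + 1)) Q := by
    have h1 := memLp_id_gaussianReal (μ := 0) (v := 1) 1
    rw [ENNReal.coe_one, ← (hlaw (n + 1)).map_eq] at h1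
    exact memLp_one_iff_integrable.mp (h1.comp_of_map (hlaw (n + 1)).aemeasurable)
  have h0 : Q[ξ (n + 1)] = 0 := by
    rw [(hlaw (n + 1)).integral_eq, integral_id_gaussianReal]
  have h1 := hξ.condExp_natural_ae_eq_of_lt hm (Nat.lt_succ_self n)
  have h2 : (fun ω => ∑ j ∈ Finset.range (n + 1 + 1), ξ j ω * a j)
      = (fun ω => ∑ j ∈ Finset.range (n + 1), ξ j ω * a j) + a (n + 1) • ξ (n + 1) := by
    ext ω
    rw [Finset.sum_range_succ, Pi.add_apply, Pi.smul_apply, smul_eq_mul, mul_comm (a _)]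
  rw [h2]
  have h3 := condExp_of_stronglyMeasurable ((Filtration.natural ξ hm).le n) (hadp n)
    (hint (n + 1))
  filter_upwards [h1, condExp_add (hint (n + 1)) (hξi.smul (a (n + 1)))
    (Filtration.natural ξ hm n), condExp_smul (μ := Q) (a (n + 1)) (ξ (n + 1))
    (Filtration.natural ξ hm n)] with ω h4 h5 h6
  rw [h5, Pi.add_apply, h6, Pi.smul_apply, h4, h0, h3]
  simp

/-- A Gaussian series with square summable coefficients converges almost surely, and its partial
sums are conditional expectations of its sum. -/
lemma exists_ae_tendsto_gaussian_sum (hξ : iIndepFun ξ Q) (hm : ∀ j, StronglyMeasurable (ξ j))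
    (hlaw : ∀ j, HasLaw (ξ j) (gaussianReal 0 1) Q) {a : ℕ → ℝ} {B : ℝ}
    (hB : ∀ n, ∑ j ∈ Finset.range n, (a j) ^ 2 ≤ B) :
    ∃ Z : Ω → ℝ, Measurable Z ∧
      (∀ᵐ ω ∂Q, Tendsto (fun n => ∑ j ∈ Finset.range n, ξ j ω * a j) atTop (𝓝 (Z ω))) ∧
      ∀ n, (fun ω => ∑ j ∈ Finset.range (n + 1), ξ j ω * a j)
        =ᵐ[Q] Q[Z | Filtration.natural ξ hm n] := by
  have := hξ.isProbabilityMeasure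
  have hmart := martingale_gaussian_sum hξ hm hlaw a
  have hui := uniformIntegrable_of_integral_sq_le
    (fun n => memLp_gaussian_sum hξ hlaw a (n + 1)) (B := B)
    (fun n => (integral_sq_gaussian_sum hξ hlaw a (n + 1)).trans_le (hB (n + 1)))
  obtain ⟨R, hR⟩ := hui.2.2
  refine ⟨_, (Filtration.stronglyMeasurable_limitProcess.mono
    (sSup_le fun _ ⟨_, hn⟩ => hn ▸ (Filtration.natural ξ hm).le _)).measurable, ?_,
    hmart.ae_eq_condExp_limitProcess hui⟩
  filter_upwards [hmart.submartingale.ae_tendsto_limitProcess hR] with ω hω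
  exact (tendsto_add_atTop_iff_nat 1).mp hω

end GaussianSeries

/-! ### Separating functionals and lifting to the Banach space -/

section Separating

/-- The dual of a separable normed space contains a separating sequence. -/
lemma exists_separating_dual_seq (E : Type*) [NormedAddCommGroup E] [NormedSpace ℝ E]
    [SecondCountableTopology E] :
    ∃ v : ℕ → StrongDual ℝ E, ∀ x y : E, (∀ k, v k x = v k y) → x = y := by
  choose v hv1 hv2 using fun k => exists_dual_vector'' ℝ (TopologicalSpace.denseSeq E k)
  refine ⟨v, fun x y hxy => ?_⟩
  rw [← sub_eq_zero, ← norm_le_zero_iff]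
  refine le_of_forall_pos_le_add fun ε hε => ?_
  obtain ⟨k, hk⟩ := (TopologicalSpace.denseRange_denseSeq E).exists_dist_lt (x - y)
    (ε := ε / 2) (by positivity)
  set z := TopologicalSpace.denseSeq E k
  -- `v k` vanishes on x − y, is norming at z and has norm at most 1.
  have h1 : ‖z‖ ≤ ‖x - y - z‖ := by
    have h2 : v k (x - y - z) = -‖z‖ := by
      rw [map_sub, map_sub, hxy k, sub_self, zero_sub, hv2 k]
      rfl
    have h3 := (v k).le_of_opNorm_le (hv1 k) (x - y - z)
    rwa [h2, norm_neg, norm_norm, one_mul] at h3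
  rw [dist_eq_norm] at hk
  have h4 := norm_add_le (x - y - z) z
  rw [sub_add_cancel] at h4
  linarith

variable {Ω Ω' E : Type*} [MeasurableSpace Ω] [MeasurableSpace Ω'] [NormedAddCommGroup E]
  [NormedSpace ℝ E] [CompleteSpace E] [SecondCountableTopology E] [MeasurableSpace E]
  [BorelSpace E] {P : Measure Ω} {Q : Measure Ω'}

/-- If real random variables `Z k` have the joint distribution of `v k (X)`, where `v` is a
separating sequence of functionals, then they are the images `v k (Y)` of a random vector `Y`
distributed as `X`. -/
lemma exists_identDistrib_of_map_eq {v : ℕ → StrongDual ℝ E}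
    (hv : ∀ x y : E, (∀ k, v k x = v k y) → x = y) {X : Ω → E} (hX : AEMeasurable X P)
    {Z : ℕ → Ω' → ℝ} (hZ : ∀ k, Measurable (Z k))
    (h : P.map (fun ω k => v k (X ω)) = Q.map (fun ω k => Z k ω)) :
    ∃ Y : Ω' → E, IdentDistrib X Y P Q ∧ ∀ᵐ ω ∂Q, ∀ k, v k (Y ω) = Z k ω := by
  let Φ : E → ℕ → ℝ := fun x k => v k x
  have hΦm : Measurable Φ := measurable_pi_lambda _ fun k => (v k).measurable
  -- Lusin–Souslin: an injective Borel map on a Polish space has measurable range and a measurable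
  -- left inverse, here `Ψ`.
  have hΦ : MeasurableEmbedding Φ :=
    hΦm.measurableEmbedding fun x y hxy => hv x y fun k => congrFun hxy k
  obtain ⟨Ψ, hΨ, hΨΦ⟩ := hΦ.exists_measurable_extend measurable_id fun _ => ⟨(0 : E)⟩
  have hZm : Measurable fun ω k => Z k ω := measurable_pi_lambda _ hZ
  have hXm : AEMeasurable (fun ω => Φ (X ω)) P := hΦm.comp_aemeasurable hX
  refine ⟨fun ω => Ψ fun k => Z k ω, ⟨hX, (hΨ.comp hZm).aemeasurable, ?_⟩, ?_⟩
  · have h1 : Q.map (fun ω => Ψ fun k => Z k ω) = (Q.map fun ω k => Z k ω).map Ψ :=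
      (Measure.map_map hΨ hZm).symm
    rw [h1, ← h, AEMeasurable.map_map_of_aemeasurable hΨ.aemeasurable hXm]
    congr 1
    ext ω
    exact (congrFun hΨΦ (X ω)).symm
  · have h1 : ∀ᵐ z ∂(Q.map fun ω k => Z k ω), z ∈ Set.range Φ := by
      rw [← h]
      exact (ae_map_iff hXm hΦ.measurableSet_range).mpr (ae_of_all _ fun ω => ⟨X ω, rfl⟩)
    filter_upwards [(ae_map_iff hZm.aemeasurable hΦ.measurableSet_range).mp h1] with ω hω k
    obtain ⟨x, hx⟩ := hω
    have h2 : Ψ (Φ x) = x := congrFun hΨΦ x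
    rw [← hx, h2, ← congrFun hx k]

end Separating

/-! ### Admissibility as a covariance identity -/

section Admissible

lemma ae_tendsto_apply {Ω E : Type*} [MeasurableSpace Ω] [NormedAddCommGroup E]
    [NormedSpace ℝ E] {Q : Measure Ω} {ξ : ℕ → Ω → ℝ} {f : ℕ → E} {Y : Ω → E}
    (hY : ∀ᵐ ω ∂Q, Tendsto (fun n : ℕ => ∑ j ∈ Finset.range n, ξ j ω • f j) atTop (𝓝 (Y ω)))
    (u : StrongDual ℝ E) :
    ∀ᵐ ω ∂Q, Tendsto (fun n : ℕ => ∑ j ∈ Finset.range n, ξ j ω * u (f j)) atTop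
      (𝓝 (u (Y ω))) := by
  filter_upwards [hY] with ω hω
  have h := (u.continuous.tendsto _).comp hω
  simpa [Function.comp_def] using h

variable {Ω Ω' E : Type*} [MeasurableSpace Ω] [MeasurableSpace Ω'] [NormedAddCommGroup E]
  [NormedSpace ℝ E] [CompleteSpace E] [SecondCountableTopology E] [MeasurableSpace E]
  [BorelSpace E] {P : Measure Ω} [IsProbabilityMeasure P] {Q : Measure Ω'} {X : Ω → E}
  {ξ : ℕ → Ω' → ℝ} {f : ℕ → E}

lemma integral_exp_dual_of_gaussian (hX : HasGaussianLaw X P) (hX0 : ∫ ω, X ω ∂P = 0)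
    (u : StrongDual ℝ E) :
    ∫ ω, Complex.exp (u (X ω) * Complex.I) ∂P
      = Complex.exp (-(u (covOperator X P u) : ℂ) / 2) := by
  have h0 : P[u ∘ X] = 0 := by
    have h1 := u.integral_comp_comm ((memLp_two_of_gaussian hX).integrable one_le_two)
    rw [hX0, map_zero] at h1
    exact h1
  have hm : AEMeasurable (u ∘ X) P := u.measurable.comp_aemeasurable hX.aemeasurable
  have h1 := hX.charFunDual_map_eq u
  rw [charFunDual_apply, integral_map hX.aemeasurable (by fun_prop), h0,
    variance_of_integral_eq_zero hm h0] at h1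
  rw [h1, apply_covOperator hX]
  congr 1
  simp only [Function.comp_apply, sq]
  push_cast
  ring

/-- The exponents are real, so taking moduli and logarithms recovers them. -/
lemma tendsto_of_tendsto_exp_neg_half {s : ℕ → ℝ} {c : ℝ}
    (h : Tendsto (fun n => Complex.exp (-(s n : ℂ) / 2)) atTop (𝓝 (Complex.exp (-(c : ℂ) / 2)))) :
    Tendsto s atTop (𝓝 c) := by
  have h1 := h.norm
  simp only [Complex.norm_exp] at h1
  have h2 := (h1.log (Real.exp_ne_zero _)).const_mul (-2)
  simp only [Real.log_exp] at h2
  have h3 : ∀ x : ℝ, -2 * (-(x : ℂ) / 2).re = x := by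
    intro x
    rw [show (-(x : ℂ) / 2) = ((-x / 2 : ℝ) : ℂ) by push_cast; ring, Complex.ofReal_re]
    ring
  simpa only [h3] using h2

/-- If `f` is admissible for `X`, then `∑ j, ⟨u, f j⟩² = ⟨u, C u⟩` for all `u`. -/
lemma IsAdmissible.tendsto_sum_sq (hX : HasGaussianLaw X P) (hX0 : ∫ ω, X ω ∂P = 0)
    (hξ : iIndepFun ξ Q) (hlaw : ∀ j, HasLaw (ξ j) (gaussianReal 0 1) Q)
    (h : IsAdmissible X P ξ Q f) (u : StrongDual ℝ E) :
    Tendsto (fun n : ℕ => ∑ j ∈ Finset.range n, (u (f j)) ^ 2) atTop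
      (𝓝 (u (covOperator X P u))) := by
  obtain ⟨Y, hY, hXY⟩ := h
  have h1 := tendsto_exp_of_ae_tendsto_gaussian_sum hξ hlaw (ae_tendsto_apply hY u)
  have hm : Measurable fun x : E => Complex.exp (u x * Complex.I) := by fun_prop
  have h2 := (hXY.comp hm).integral_eq
  simp only [Function.comp_def] at h2
  rw [← h2, integral_exp_dual_of_gaussian hX hX0] at h1
  exact tendsto_of_tendsto_exp_neg_half h1

/-- Used twice: for the law of the sum in `E`, and for the finite-dimensional marginals of the
scalar limits. -/
lemma integral_exp_eq_of_ae_tendsto (hX : HasGaussianLaw X P) (hX0 : ∫ ω, X ω ∂P = 0)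
    (hξ : iIndepFun ξ Q) (hlaw : ∀ j, HasLaw (ξ j) (gaussianReal 0 1) Q)
    {u : StrongDual ℝ E}
    (h : Tendsto (fun n : ℕ => ∑ j ∈ Finset.range n, (u (f j)) ^ 2) atTop
      (𝓝 (u (covOperator X P u)))) {Z : Ω' → ℝ}
    (hZ : ∀ᵐ ω ∂Q, Tendsto (fun n => ∑ j ∈ Finset.range n, ξ j ω * u (f j)) atTop (𝓝 (Z ω))) :
    ∫ ω, Complex.exp (u (X ω) * Complex.I) ∂P = ∫ ω, Complex.exp (Z ω * Complex.I) ∂Q := by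
  rw [integral_exp_dual_of_gaussian hX hX0]
  refine tendsto_nhds_unique ?_ (tendsto_exp_of_ae_tendsto_gaussian_sum hξ hlaw hZ)
  have hc : Continuous fun x : ℝ => Complex.exp (-(x : ℂ) / 2) := by fun_prop
  exact (hc.tendsto _).comp h

/-- If the Gaussian series converges almost surely and has the right covariance, then `f` is
admissible. -/
lemma isAdmissible_of_ae_exists_tendsto (hX : HasGaussianLaw X P) (hX0 : ∫ ω, X ω ∂P = 0)
    (hξ : iIndepFun ξ Q) (hlaw : ∀ j, HasLaw (ξ j) (gaussianReal 0 1) Q)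
    (h : ∀ u : StrongDual ℝ E, Tendsto (fun n : ℕ => ∑ j ∈ Finset.range n, (u (f j)) ^ 2) atTop
      (𝓝 (u (covOperator X P u))))
    (hc : ∀ᵐ ω ∂Q, ∃ y, Tendsto (fun n : ℕ => ∑ j ∈ Finset.range n, ξ j ω • f j) atTop (𝓝 y)) :
    IsAdmissible X P ξ Q f := by
  have := hξ.isProbabilityMeasure
  have hm : ∀ n : ℕ, AEMeasurable (fun ω => ∑ j ∈ Finset.range n, ξ j ω • f j) Q := fun n =>
    Finset.aemeasurable_fun_sum _ fun j _ => (hlaw j).aemeasurable.smul_const _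
  obtain ⟨Y, hYm, hY⟩ := measurable_limit_of_tendsto_metrizable_ae hm hc
  refine ⟨Y, hY, hX.aemeasurable, hYm.aemeasurable, ?_⟩
  have := Measure.isProbabilityMeasure_map (μ := P) hX.aemeasurable
  have := Measure.isProbabilityMeasure_map (μ := Q) hYm.aemeasurable
  refine Measure.ext_of_charFunDual (funext fun u => ?_)
  rw [charFunDual_apply, charFunDual_apply, integral_map hX.aemeasurable (by fun_prop),
    integral_map hYm.aemeasurable (by fun_prop)]
  exact integral_exp_eq_of_ae_tendsto hX hX0 hξ hlaw (h u) (ae_tendsto_apply hY u)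

/-- The scalar Gaussian series `∑ j, ξ j ⟨v k, f j⟩` have the joint distribution of `⟨v k, X⟩`. -/
lemma map_dual_seq_eq_of_ae_tendsto (hX : HasGaussianLaw X P) (hX0 : ∫ ω, X ω ∂P = 0)
    (hξ : iIndepFun ξ Q) (hlaw : ∀ j, HasLaw (ξ j) (gaussianReal 0 1) Q)
    (h : ∀ u : StrongDual ℝ E, Tendsto (fun n : ℕ => ∑ j ∈ Finset.range n, (u (f j)) ^ 2) atTop
      (𝓝 (u (covOperator X P u))))
    (v : ℕ → StrongDual ℝ E) {Z : ℕ → Ω' → ℝ} (hZ : ∀ k, Measurable (Z k))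
    (hlim : ∀ k, ∀ᵐ ω ∂Q,
      Tendsto (fun n => ∑ j ∈ Finset.range n, ξ j ω * v k (f j)) atTop (𝓝 (Z k ω))) :
    P.map (fun ω k => v k (X ω)) = Q.map (fun ω k => Z k ω) := by
  have := hξ.isProbabilityMeasure
  have hvX : AEMeasurable (fun ω k => v k (X ω)) P :=
    aemeasurable_pi_lambda _ fun k => (v k).measurable.comp_aemeasurable hX.aemeasurable
  have hZm : Measurable fun ω k => Z k ω := measurable_pi_lambda _ hZ
  have h1 := isProjectiveLimit_map (X := fun k ω => v k (X ω)) hvX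
  have h2 := isProjectiveLimit_map (P := Q) (X := Z) hZm.aemeasurable
  -- A law on sequences is determined by its finite marginals, and these by their characteristic
  -- functions.
  refine IsProjectiveLimit.unique h1 ?_
  convert h2 using 1
  funext I
  have hm1 : AEMeasurable (fun ω => I.restrict fun k => v k (X ω)) P :=
    (Finset.measurable_restrict I).comp_aemeasurable hvX
  have hm2 : AEMeasurable (fun ω => I.restrict fun k => Z k ω) Q :=
    (Finset.measurable_restrict I).comp_aemeasurable hZm.aemeasurable
  have := Measure.isProbabilityMeasure_map (μ := P) hm1
  have := Measure.isProbabilityMeasure_map (μ := Q) hm2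
  refine Measure.ext_of_charFunDual (funext fun L => ?_)
  rw [charFunDual_apply, charFunDual_apply, integral_map hm1 (by fun_prop),
    integral_map hm2 (by fun_prop)]
  let c : I → ℝ := fun i => L fun j => if i = j then 1 else 0
  have hL : ∀ x : I → ℝ, L x = ∑ i, x i * c i := fun x => L.toLinearMap.pi_apply_eq_sum_univ x
  -- A functional `L` of finitely many coordinates ⟨v_i, X⟩ is a single functional `u` of X, to
  -- which the identity for `u` applies.
  let u : StrongDual ℝ E := ∑ i : I, c i • v i
  have hu : ∀ x : E, L (I.restrict fun k => v k x) = u x := by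
    intro x
    simp [hL, u, mul_comm]
  simp only [hu]
  refine integral_exp_eq_of_ae_tendsto hX hX0 hξ hlaw (h u) ?_
  filter_upwards [ae_all_iff.mpr hlim] with ω hω
  rw [hL]
  refine (tendsto_finsetSum _ fun (i : I) _ => (hω i).mul_const (c i)).congr fun n => ?_
  simp only [Finset.sum_mul]
  rw [Finset.sum_comm]
  refine Finset.sum_congr rfl fun j _ => ?_
  simp only [u, sum_apply, smul_apply, smul_eq_mul, Finset.mul_sum]
  exact Finset.sum_congr rfl fun i _ => by ring

/-- Once the scalar limits are lifted to an integrable Y in `E`, testing against the separating v_k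
identifies E[Y | ξ_0, …, ξ_n] with the partial sum of n + 1 terms. -/
lemma ae_exists_tendsto_gaussian_series (hX : HasGaussianLaw X P) (hX0 : ∫ ω, X ω ∂P = 0)
    (hξ : iIndepFun ξ Q) (hm : ∀ j, StronglyMeasurable (ξ j))
    (hlaw : ∀ j, HasLaw (ξ j) (gaussianReal 0 1) Q)
    (h : ∀ u : StrongDual ℝ E, Tendsto (fun n : ℕ => ∑ j ∈ Finset.range n, (u (f j)) ^ 2) atTop
      (𝓝 (u (covOperator X P u)))) :
    ∀ᵐ ω ∂Q, ∃ y, Tendsto (fun n : ℕ => ∑ j ∈ Finset.range n, ξ j ω • f j) atTop (𝓝 y) := by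
  have := hξ.isProbabilityMeasure
  obtain ⟨v, hv⟩ := exists_separating_dual_seq E
  have hb : ∀ k n, ∑ j ∈ Finset.range n, (v k (f j)) ^ 2 ≤ v k (covOperator X P (v k)) := by
    intro k n
    refine (monotone_nat_of_le_succ fun i => ?_).ge_of_tendsto (h (v k)) n
    rw [Finset.sum_range_succ]
    exact le_add_of_nonneg_right (sq_nonneg _)
  choose Z hZm hZ hZc using fun k => exists_ae_tendsto_gaussian_sum hξ hm hlaw (hb k)
  obtain ⟨Y, hXY, hYZ⟩ := exists_identDistrib_of_map_eq hv hX.aemeasurable hZm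
    (map_dual_seq_eq_of_ae_tendsto hX hX0 hξ hlaw h v hZm hZ)
  have hYi : Integrable Y Q :=
    hXY.integrable_iff.mp ((memLp_two_of_gaussian hX).integrable one_le_two)
  have h1 : ∀ᵐ ω ∂Q, ∀ n k, v k ((Q[Y | Filtration.natural ξ hm n]) ω)
      = ∑ j ∈ Finset.range (n + 1), ξ j ω * v k (f j) := by
    refine ae_all_iff.mpr fun n => ae_all_iff.mpr fun k => ?_
    have h2 : v k ∘ Y =ᵐ[Q] Z k := by
      filter_upwards [hYZ] with ω hω using hω k
    filter_upwards [(v k).comp_condExp_comm (m := Filtration.natural ξ hm n) hYi,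
      condExp_congr_ae (m := Filtration.natural ξ hm n) h2, hZc k n] with ω h3 h4 h5
    rw [h5, ← h4, ← h3, Function.comp_apply]
  filter_upwards [h1, ae_exists_tendsto_condExp (Filtration.natural ξ hm) hYi] with ω h2 h3
  obtain ⟨y, hy⟩ := h3
  refine ⟨y, (tendsto_add_atTop_iff_nat 1).mp (hy.congr fun n => hv _ _ fun k => ?_)⟩
  rw [h2 n k]
  simp

lemma isAdmissible_iff_tendsto_sum_sq (hX : HasGaussianLaw X P) (hX0 : ∫ ω, X ω ∂P = 0)
    (hξ : iIndepFun ξ Q) (hlaw : ∀ j, HasLaw (ξ j) (gaussianReal 0 1) Q) :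
    IsAdmissible X P ξ Q f ↔
      ∀ u : StrongDual ℝ E, Tendsto (fun n : ℕ => ∑ j ∈ Finset.range n, (u (f j)) ^ 2) atTop
        (𝓝 (u (covOperator X P u))) := by
  refine ⟨fun h u => h.tendsto_sum_sq hX hX0 hξ hlaw u, fun h => ?_⟩
  refine isAdmissible_of_ae_exists_tendsto hX hX0 hξ hlaw h ?_
  -- The natural filtration requires genuinely measurable variables; passing to measurable versions
  -- changes the series only on a null set.
  have hae : ∀ j, ξ j =ᵐ[Q] (hlaw j).aemeasurable.mk (ξ j) := fun j =>
    (hlaw j).aemeasurable.ae_eq_mk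
  have h1 := ae_exists_tendsto_gaussian_series hX hX0 (hξ.congr hae)
    (fun j => (hlaw j).aemeasurable.measurable_mk.stronglyMeasurable)
    (fun j => (hlaw j).congr (hae j).symm) h
  filter_upwards [h1, ae_all_iff.mpr hae] with ω h2 h3
  simpa only [h3] using h2

end Admissible

theorem theorem1
    {E : Type*} [NormedAddCommGroup E] [NormedSpace ℝ E] [CompleteSpace E]
    [SecondCountableTopology E] [MeasurableSpace E] [BorelSpace E]
    {Ω : Type*} [MeasurableSpace Ω] (P : Measure Ω) [IsProbabilityMeasure P]
    (X : Ω → E) (hX : HasGaussianLaw X P) (hX0 : ∫ ω, X ω ∂P = 0)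
    {Ω' : Type*} [MeasurableSpace Ω'] (Q : Measure Ω') [IsProbabilityMeasure Q]
    (ξ : ℕ → Ω' → ℝ) (hξ_indep : iIndepFun ξ Q)
    (hξ_law : ∀ j, HasLaw (ξ j) (gaussianReal 0 1) Q)
    (f : ℕ → E) :
    IsAdmissible X P ξ Q f ↔
      ∃ g : ℕ → CameronMartinSpace hX,
        (∀ j, CameronMartinSpace.inclusion hX (g j) = f j) ∧ IsParsevalFrame g := by
  rw [isAdmissible_iff_tendsto_sum_sq hX hX0 hξ_indep hξ_law,
    CameronMartinSpace.exists_isParsevalFrame_iff]
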